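/- Let $F$ be a connected (finite-dimensional, Hausdorff) complex manifold and let $G$ be a subgroup of the group of holomorphic diffeomorphisms of $F$ (bijections $F\to F$ that are holomorphic together with their inverse), under composition. Assume that 1. either $G$ has finite exponent, i.e. there is an integer $m\ge 1$ with $g^m=1$ for all $g\in G$, or $G$ is finitely generated and periodic, i.e. every element of $G$ has finite order; and 2. $G$ has a finite orbit in $F$, i.e. there is a point $x\in F$ such that $\{g(x) : g\in G\}$ is finite. Then $G$ is a finite group. -/

import Mathlib

open scoped Manifold ContDiff

/-- The holomorphic diffeomorphisms (biholomorphic self-maps) of a complex manifold `F` modelled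
on the complex normed space `E`: the bijections of `F` that are complex analytic together with
their inverse. -/
abbrev HolomorphicDiffeo (E F : Type*) [NormedAddCommGroup E] [NormedSpace ℂ E]
    [TopologicalSpace F] [ChartedSpace E F] :=
  Diffeomorph 𝓘(ℂ, E) 𝓘(ℂ, E) F F ω

namespace HolomorphicDiffeo

/-- Composition makes the holomorphic diffeomorphisms of `F` into a group: `f * g = f ∘ g`. -/
noncomputable instance instGroup (E F : Type*) [NormedAddCommGroup E] [NormedSpace ℂ E]
    [TopologicalSpace F] [ChartedSpace E F] : Group (HolomorphicDiffeo E F) where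
  mul f g := g.trans f
  one := Diffeomorph.refl 𝓘(ℂ, E) F ω
  inv f := f.symm
  mul_assoc _ _ _ := rfl
  one_mul _ := rfl
  mul_one _ := rfl
  inv_mul_cancel f := Diffeomorph.ext fun x => f.symm_apply_apply x

/-- The tautological action of the holomorphic diffeomorphisms on `F`: `f • x = f x`. -/
noncomputable instance instMulAction (E F : Type*) [NormedAddCommGroup E] [NormedSpace ℂ E]
    [TopologicalSpace F] [ChartedSpace E F] : MulAction (HolomorphicDiffeo E F) F where
  smul f x := f x
  one_smul _ := rfl
  mul_smul _ _ _ := rfl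

end HolomorphicDiffeo

/-! A point with finite orbit has a stabilizer of finite index, so it suffices that this stabilizer
is finite. It acts on the tangent space at the point, and this action is faithful
(`isotropyRep_injective`): averaging a chart over the powers of a finite-order map with trivial
derivatives shows that the map is the identity nearby, and the identity theorem makes it the
identity. The stabilizer is thus a complex linear group that has finite exponent (Burnside) or is
finitely generated and periodic (Schur). -/

section LinearGroups

/-! ### Burnside's theorem, by traces. -/

theorem Module.End.eq_one_of_forall_trace_pow_eq {K V : Type*} [Field K] [CharZero K]
    [AddCommGroup V] [Module K V] [FiniteDimensional K V] {u : Module.End K V} {m : ℕ}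
    (hm : 0 < m) (hu : u ^ m = 1)
    (htr : ∀ k, LinearMap.trace K V (u ^ k) = LinearMap.trace K V 1) : u = 1 := by
  have hm0 : (m : K) ≠ 0 := by exact_mod_cast hm.ne'
  set S : Module.End K V := ∑ k ∈ Finset.range m, u ^ k with hS
  have huS : u * S = S := by
    have h := Finset.sum_range_succ' (fun k => u ^ k) m
    rw [Finset.sum_range_succ, hu, pow_zero] at h
    rw [hS, Finset.mul_sum]
    simpa [pow_succ'] using (add_right_cancel h).symm
  have hpow : ∀ k, u ^ k * S = S := fun k => by
    induction k with
    | zero => simp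
    | succ k ih => rw [pow_succ, mul_assoc, huS, ih]
  have hSS : S * S = (m : K) • S := by
    conv_lhs => rw [hS]
    rw [Finset.sum_mul, Finset.sum_congr rfl fun k _ => hpow k]
    simp [Nat.cast_smul_eq_nsmul]
  set P : Module.End K V := (m : K)⁻¹ • S with hP
  have hPP : IsIdempotentElem P := by
    simp only [IsIdempotentElem, hP, smul_mul_assoc, mul_smul_comm, hSS, smul_smul]
    congr 1
    field_simp
  have htrP : LinearMap.trace K V (1 - P) = 0 := by
    rw [map_sub, hP, map_smul, hS, map_sum, Finset.sum_congr rfl fun k _ => htr k]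
    simp [hm0]
  have h1P : 1 - P = 0 :=
    (LinearMap.IsIdempotentElem.trace_eq_zero_iff hPP.one_sub).1 htrP
  have hPone : P = 1 := (sub_eq_zero.1 h1P).symm
  calc u = u * P := by rw [hPone, mul_one]
    _ = P := by rw [hP, mul_smul_comm, huS]
    _ = 1 := hPone

/-- Such a trace is a sum of `finrank K V` many `m`-th roots of unity. -/
theorem Module.End.finite_setOf_trace_of_pow_eq_one (K V : Type*) [Field K] [IsAlgClosed K]
    [AddCommGroup V] [Module K V] [FiniteDimensional K V] {m : ℕ} (hm : 0 < m) :
    {t : K | ∃ f : Module.End K V, f ^ m = 1 ∧ LinearMap.trace K V f = t}.Finite := by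
  have hroots : {z : K | z ^ m = 1}.Finite := by
    refine (Polynomial.nthRootsFinset m (1 : K)).finite_toSet.subset fun z hz => ?_
    simpa [Polynomial.mem_nthRootsFinset hm] using hz
  have : Finite {z : K | z ^ m = 1} := hroots
  refine (Set.finite_range fun s : Sym {z : K | z ^ m = 1} (Module.finrank K V) =>
    (s.1.map Subtype.val).sum).subset ?_
  rintro t ⟨f, hf, rfl⟩
  have hmem : ∀ z ∈ f.charpoly.roots, z ^ m = 1 := by
    intro z hz
    have hev : f.HasEigenvalue z :=
      (Module.End.hasEigenvalue_iff_isRoot_charpoly f z).2 (Polynomial.isRoot_of_mem_roots hz)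
    obtain ⟨v, hv⟩ := hev.exists_hasEigenvector
    have h := hv.pow_apply m
    rw [hf, Module.End.one_apply] at h
    by_contra hne
    exact hv.2 ((smul_eq_zero.1 (show (z ^ m - 1) • v = 0 by
      rw [sub_smul, ← h, one_smul, sub_self])).resolve_left (sub_ne_zero.2 hne))
  refine ⟨⟨f.charpoly.roots.attach.map fun z => ⟨z.1, hmem z.1 z.2⟩, ?_⟩, ?_⟩
  · rw [Multiset.card_map, Multiset.card_attach,
      ← (IsAlgClosed.splits f.charpoly).natDegree_eq_card_roots, LinearMap.charpoly_natDegree]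
  · rw [Module.End.trace_eq_sum_roots_charpoly_of_splits (IsAlgClosed.splits _)]
    simp [Multiset.map_map]

/-- **Burnside's theorem**: a linear group of finite exponent in characteristic zero is finite. -/
theorem finite_of_exponentExists_of_injective_end {H K V : Type*} [Group H] [Field K]
    [IsAlgClosed K] [CharZero K] [AddCommGroup V] [Module K V] [FiniteDimensional K V]
    (hH : Monoid.ExponentExists H) (ρ : H →* Module.End K V) (hρ : Function.Injective ρ) :
    Finite H := by
  obtain ⟨m, hm, hpow⟩ := hH
  obtain ⟨b, hb, hspan, hli⟩ := exists_linearIndependent K (Set.range ρ)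
  have hbfin : Finite b := hli.finite
  have hT := Module.End.finite_setOf_trace_of_pow_eq_one K V hm
  set T := {t : K | ∃ f : Module.End K V, f ^ m = 1 ∧ LinearMap.trace K V f = t}
  have : Finite T := hT
  -- `b` is a basis of the span of the image, taken from the image itself, so every trace below lies
  -- in the finite set `T`.
  refine Finite.of_injective (β := b → T) (fun g a => ⟨LinearMap.trace K V (ρ g * a.1), by
    obtain ⟨h, hh⟩ := hb a.2
    exact ⟨ρ g * a.1, by rw [← hh, ← map_mul, ← map_pow, hpow, map_one], rfl⟩⟩) ?_
  intro g h hgh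
  have hbasis : ∀ a ∈ b, LinearMap.trace K V (ρ g * a) = LinearMap.trace K V (ρ h * a) :=
    fun a ha => congrArg Subtype.val (congrFun hgh ⟨a, ha⟩)
  have hall : ∀ k, LinearMap.trace K V (ρ g * ρ k) = LinearMap.trace K V (ρ h * ρ k) := by
    intro k
    have hk : ρ k ∈ Submodule.span K b := hspan ▸ Submodule.subset_span ⟨k, rfl⟩
    generalize ρ k = x at hk
    induction hk using Submodule.span_induction with
    | mem x hx => exact hbasis x hx
    | zero => simp
    | add x y _ _ hx hy => simp [mul_add, hx, hy]
    | smul c x _ hx => simp [hx]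
  have hone : ρ (h⁻¹ * g) = 1 := by
    refine Module.End.eq_one_of_forall_trace_pow_eq hm (by rw [← map_pow, hpow, map_one]) ?_
    intro k
    induction k with
    | zero => simp
    | succ k ih =>
      have hcomm : ∀ x y, LinearMap.trace K V (ρ (x * y)) = LinearMap.trace K V (ρ (y * x)) :=
        fun x y => by rw [ρ.map_mul, ρ.map_mul, LinearMap.trace_mul_comm]
      -- By `hall` and cyclicity of the trace, one factor `g` may be replaced by `h`, which then
      -- cancels an `h⁻¹`.
      rw [← ih, ← ρ.map_pow, ← ρ.map_pow, pow_succ', mul_assoc, hcomm, mul_assoc, ρ.map_mul, hall,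
        ← ρ.map_mul, ← mul_assoc, hcomm, ← mul_assoc, inv_mul_cancel, one_mul]
  exact (inv_mul_eq_one.1 ((injective_iff_map_eq_one ρ).1 hρ _ hone)).symm


/-! ### Schur's theorem, by reduction modulo maximal ideals. -/

theorem Int.isJacobsonRing : IsJacobsonRing ℤ := by
  rw [isJacobsonRing_iff_prime_eq]
  intro P hP
  by_cases hbot : P = ⊥
  · subst hbot
    rw [eq_bot_iff]
    intro x hx
    have h := Ideal.mem_jacobson_bot.1 hx x
    rw [Int.isUnit_iff] at h
    rcases h with h | h
    · simpa using h
    · nlinarith [mul_self_nonneg x]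
  · exact (Ideal.jacobson_eq_self_of_isMaximal (H := hP.isMaximal hbot))

theorem exists_prime_charP_and_finite_of_finiteType_int (k : Type*) [Field k]
    (hk : (Int.castRingHom k).FiniteType) : (∃ p : ℕ, p.Prime ∧ CharP k p) ∧ Finite k := by
  have := Int.isJacobsonRing
  have : Algebra.FiniteType ℤ k := RingHom.finiteType_algebraMap.1 hk
  have hfin : Module.Finite ℤ k := finite_of_finite_type_of_isJacobsonRing ℤ k
  obtain ⟨p, hp⟩ := CharP.exists k
  rcases CharP.char_is_prime_or_zero k p with hpp | rfl
  · refine ⟨⟨p, hpp, hp⟩, ?_⟩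
    have : Fact p.Prime := ⟨hpp⟩
    let _ : Algebra (ZMod p) k := ZMod.algebra k p
    have : Module.Finite (ZMod p) k := Module.Finite.of_restrictScalars_finite ℤ (ZMod p) k
    exact Module.finite_of_finite (ZMod p)
  · have : CharZero k := CharP.charP_to_charZero k
    have hint : Algebra.IsIntegral ℤ k := Algebra.IsIntegral.of_finite ℤ k
    have hinj : Function.Injective (algebraMap ℤ k) := FaithfulSMul.algebraMap_injective ℤ k
    exact absurd (isField_of_isIntegral_of_isField hinj (Field.toIsField k)) Int.not_isField

theorem one_add_pow_eq {A : Type*} [Ring A] (x : A) (q : ℕ) :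
    ∃ y, (1 + x) ^ q = 1 + (q : A) * x + x * x * y := by
  induction q with
  | zero => exact ⟨0, by simp⟩
  | succ q ih =>
    obtain ⟨y, hy⟩ := ih
    refine ⟨(q : A) + y + y * x, ?_⟩
    have h : (q : A) * x = x * q := Nat.cast_commute q x
    have h2 : x * x * (q : A) = (q : A) * x * x := by rw [mul_assoc, ← h, ← mul_assoc, ← h]
    rw [pow_succ, hy]
    push_cast
    rw [mul_add (x * x), mul_add (x * x), h2]
    noncomm_ring

/-- With `x = g - 1`, expanding `(1 + x) ^ q = 1` gives `q x ∈ x² A`, where `A` is the matrix ring.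
As `q` is invertible modulo `M`, the entries of `x` lie in ever higher powers of `M`, hence vanish
by Krull's intersection theorem. -/
theorem Matrix.eq_one_of_pow_eq_one_of_sub_one_mem {n R : Type*} [Fintype n] [DecidableEq n]
    [CommRing R] [IsDomain R] [IsNoetherianRing R] {M : Ideal R} [hM : M.IsMaximal]
    {g : Matrix n n R} {q : ℕ} (hq : (q : R) ∉ M) (hgq : g ^ q = 1)
    (hg : ∀ i j, (g - 1) i j ∈ M) : g = 1 := by
  set x := g - 1 with hx
  have hgx : g = 1 + x := by rw [hx]; abel
  have hpow : ∀ k : ℕ, ∀ i j, x i j ∈ M ^ (k + 1) := by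
    intro k
    induction k with
    | zero => simpa using hg
    | succ k ih =>
      intro i j
      obtain ⟨y, hy⟩ := one_add_pow_eq x q
      rw [← hgx, hgq] at hy
      have h0 : (q : Matrix n n R) * x = -(x * x * y) := by
        rw [eq_neg_iff_add_eq_zero]
        rw [add_assoc] at hy
        exact (add_eq_left.1 hy.symm)
      have hij : (q : R) * x i j = -(x * x * y) i j := by
        have := congrFun (congrFun h0 i) j
        rwa [← nsmul_eq_mul, Matrix.smul_apply, nsmul_eq_mul] at this
      refine (Ideal.IsMaximal.mul_mem_pow M (a := (q : R)) ?_).resolve_left hq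
      rw [hij, Matrix.mul_apply]
      refine neg_mem (Ideal.sum_mem _ fun l _ => Ideal.mul_mem_right _ _ ?_)
      rw [Matrix.mul_apply]
      refine Ideal.sum_mem _ fun s _ => ?_
      rw [pow_succ]
      exact Ideal.mul_mem_mul (ih _ _) (Ideal.pow_le_self k.succ_ne_zero (ih s l))
  have hx0 : x = 0 := by
    ext i j
    have h : x i j ∈ ⨅ k, M ^ k := by
      rw [Ideal.mem_iInf]
      intro k
      exact Ideal.pow_le_pow_right (Nat.le_succ k) (hpow k i j)
    rwa [Ideal.iInf_pow_eq_bot_of_isDomain M hM.ne_top] at h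
  rw [hgx, hx0, add_zero]

/-- The matrix entries lie in a finitely generated ring `R`, whose residue fields are finite. `N` is
the kernel of reduction modulo a maximal ideal with residue characteristic `p`; adjoining `a⁻¹` to
`R` forces `p ∤ a`. -/
theorem exists_finiteIndex_torsion_eq_prime {H n K : Type*} [Group H] [Group.FG H] [Fintype n]
    [DecidableEq n] [Field K] [CharZero K] (ρ : H →* Matrix n n K) (hρ : Function.Injective ρ)
    {a : ℕ} (ha : a ≠ 0) :
    ∃ p : ℕ, p.Prime ∧ ¬ p ∣ a ∧ ∃ N : Subgroup H, N.FiniteIndex ∧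
      ∀ g ∈ N, ∀ q : ℕ, q.Prime → g ^ q = 1 → g ≠ 1 → q = p := by
  obtain ⟨T, hT⟩ := (Group.fg_iff_monoid_fg.1 ‹Group.FG H›).fg_top
  set S : Set K := insert (a : K)⁻¹
    (Set.range fun t : T × n × n => ρ t.1 t.2.1 t.2.2) with hS
  have hSfin : S.Finite := (Set.finite_range _).insert _
  set R := Algebra.adjoin ℤ S with hR
  have hft : Algebra.FiniteType ℤ R :=
    (Subalgebra.fg_iff_finiteType _).1 ⟨hSfin.toFinset, by simp [hR]⟩
  have hnoeth : IsNoetherianRing R := Algebra.FiniteType.isNoetherianRing ℤ R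
  have hmem : ∀ h i j, ρ h i j ∈ R := by
    intro h
    have hh : h ∈ Submonoid.closure (T : Set H) := hT ▸ Submonoid.mem_top h
    induction hh using Submonoid.closure_induction with
    | mem h hh => exact fun i j =>
        Algebra.subset_adjoin (Set.mem_insert_of_mem _ ⟨(⟨h, hh⟩, i, j), rfl⟩)
    | one =>
      intro i j
      rw [map_one, Matrix.one_apply]
      split_ifs
      exacts [R.one_mem, R.zero_mem]
    | mul x y _ _ hx hy =>
      intro i j
      rw [map_mul, Matrix.mul_apply]
      exact R.sum_mem fun l _ => R.mul_mem (hx i l) (hy l j)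
  obtain ⟨M, hM⟩ := Ideal.exists_maximal R
  let _ : Field (R ⧸ M) := Ideal.Quotient.field M
  have hftk : (Int.castRingHom (R ⧸ M)).FiniteType := by
    rw [← RingHom.eq_intCast' ((Ideal.Quotient.mk M).comp (algebraMap ℤ R))]
    exact (RingHom.FiniteType.of_surjective _ Ideal.Quotient.mk_surjective).comp
      (RingHom.finiteType_algebraMap.2 hft)
  obtain ⟨⟨p, hp, hchar⟩, hfin⟩ := exists_prime_charP_and_finite_of_finiteType_int (R ⧸ M) hftk
  let ρR : H →* Matrix n n R :=
    { toFun := fun h => Matrix.of fun i j => ⟨ρ h i j, hmem h i j⟩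
      map_one' := by
        ext i j
        simp [Matrix.one_apply, apply_ite]
      map_mul' := fun x y => by
        ext i j
        simp [Matrix.mul_apply] }
  have hρR : Function.Injective ρR := fun x y hxy => hρ <| by
    ext i j
    exact congrArg Subtype.val (congrFun (congrFun hxy i) j)
  let φ : H →* Matrix n n (R ⧸ M) :=
    ((Ideal.Quotient.mk M).mapMatrix : Matrix n n R →+* Matrix n n (R ⧸ M)).toMonoidHom.comp ρR
  have hmemM : ∀ q : ℕ, (q : R) ∈ M ↔ p ∣ q := fun q => by
    rw [← Ideal.Quotient.eq_zero_iff_mem, map_natCast, CharP.cast_eq_zero_iff (R ⧸ M) p]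
  refine ⟨p, hp, fun hpa => ?_, φ.toHomUnits.ker, inferInstance, fun g hg q hq hgq hg1 => ?_⟩
  · refine hM.ne_top ((Ideal.eq_top_iff_one M).2 ?_)
    have h1 : (1 : R) = (a : R) * ⟨(a : K)⁻¹, Algebra.subset_adjoin (Set.mem_insert _ _)⟩ := by
      ext
      have : (a : K) ≠ 0 := by exact_mod_cast ha
      simp [this]
    rw [h1]
    exact Ideal.mul_mem_right _ _ ((hmemM a).2 hpa)
  · by_contra hne
    refine hg1 ((injective_iff_map_eq_one ρR).1 hρR g ?_)
    refine Matrix.eq_one_of_pow_eq_one_of_sub_one_mem (M := M) (q := q) ?_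
      (by rw [← map_pow, hgq, map_one]) fun i j => ?_
    · rw [hmemM]
      exact fun h => hne ((Nat.prime_dvd_prime_iff_eq hp hq).1 h).symm
    · have h : φ g = 1 := congrArg Units.val (MonoidHom.mem_ker.1 hg)
      have hsub : (Ideal.Quotient.mk M).mapMatrix (ρR g - 1) = 0 := by
        rw [map_sub, map_one, sub_eq_zero]
        exact h
      exact Ideal.Quotient.eq_zero_iff_mem.1 (congrFun (congrFun hsub i) j)

/-- **Schur's theorem**: a finitely generated periodic linear group in characteristic zero is
finite. -/
theorem finite_of_fg_of_isMulTorsion_of_injective_matrix {H n K : Type*} [Group H] [Group.FG H]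
    [Fintype n] [DecidableEq n] [Field K] [CharZero K] (hH : IsMulTorsion H)
    (ρ : H →* Matrix n n K) (hρ : Function.Injective ρ) : Finite H := by
  -- Two distinct primes are needed: `a = 1` gives any `p`, then `a = p` gives `p' ≠ p`. An element
  -- of prime order in `N ⊓ N'` would have order both `p` and `p'`.
  obtain ⟨p, hp, -, N, hN, hNp⟩ := exists_finiteIndex_torsion_eq_prime ρ hρ one_ne_zero
  obtain ⟨p', hp', hpp', N', hN', hNp'⟩ := exists_finiteIndex_torsion_eq_prime ρ hρ hp.ne_zero
  have hbot : N ⊓ N' = ⊥ := by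
    rw [eq_bot_iff]
    intro g hg
    by_contra hg1
    have hord : orderOf g ≠ 1 := fun h => hg1 (orderOf_eq_one_iff.1 h)
    obtain ⟨q, hq, hqd⟩ := Nat.exists_prime_and_dvd hord
    have hpos : 0 < orderOf g := (hH g).orderOf_pos
    obtain ⟨c, hc⟩ := hqd
    have hcpos : 0 < c := Nat.pos_of_ne_zero fun h => by rw [h, mul_zero] at hc; omega
    have hgc : g ^ c ≠ 1 := fun h => by
      have h1 := Nat.le_of_dvd hcpos (orderOf_dvd_of_pow_eq_one h)
      nlinarith [hq.two_le]
    have hgcq : (g ^ c) ^ q = 1 := by rw [← pow_mul, mul_comm, ← hc, pow_orderOf_eq_one]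
    have h1 := hNp _ (N.pow_mem hg.1 c) q hq hgcq hgc
    have h2 := hNp' _ (N'.pow_mem hg.2 c) q hq hgcq hgc
    exact hpp' (by rw [← h2, h1])
  have hfi : (N ⊓ N').FiniteIndex := inferInstance
  rw [hbot] at hfi
  exact (Subgroup.finite_iff_finite_and_finiteIndex ⊥).2 ⟨inferInstance, hfi⟩

end LinearGroups

/-! ### Faithfulness of the isotropy representation. -/

namespace HolomorphicDiffeo

open Filter Topology

variable {E F : Type*} [NormedAddCommGroup E] [NormedSpace ℂ E]
    [TopologicalSpace F] [ChartedSpace E F]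

theorem eventually_eq_of_fixed_of_mfderiv_eq_id [CompleteSpace E] [IsManifold 𝓘(ℂ, E) ω F]
    {g : HolomorphicDiffeo E F} {x : F} {m : ℕ} (hm : 0 < m) (hgm : g ^ m = 1)
    (hgx : g x = x)
    (hd : ∀ k : ℕ, mfderiv 𝓘(ℂ, E) 𝓘(ℂ, E) (g ^ k : HolomorphicDiffeo E F) x =
      ContinuousLinearMap.id ℂ E) :
    ∀ᶠ y in 𝓝 x, g y = y := by
  set φ := extChartAt 𝓘(ℂ, E) x with hφ
  have hmul : ∀ (f h : HolomorphicDiffeo E F) y, (f * h) y = f (h y) := fun _ _ _ => rfl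
  have hfix : ∀ k : ℕ, (g ^ k) x = x := fun k => by
    induction k with
    | zero => rfl
    | succ k ih => rw [pow_succ, hmul, hgx, ih]
  -- `Φ` is `g`-invariant everywhere, even where `φ` takes junk values off its source. In the chart
  -- its derivative at `x` is `m • id`, so it is injective near `x`, and `Φ (g y) = Φ y` yields `g y
  -- = y`.
  set Φ : F → E := fun y => ∑ k ∈ Finset.range m, φ ((g ^ k) y) with hΦ
  have hinv : ∀ y, Φ (g y) = Φ y := fun y => by
    have h := Finset.sum_range_succ' (fun k => φ ((g ^ k) y)) m
    rw [Finset.sum_range_succ, hgm, pow_zero] at h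
    simpa [hΦ, pow_succ, hmul] using (add_right_cancel h).symm
  have hstrict : ∀ k : ℕ, HasStrictFDerivAt (fun z => φ ((g ^ k) (φ.symm z)))
      (ContinuousLinearMap.id ℂ E) (φ x) := fun k => by
    have hk := (contMDiffAt_iff.1 ((g ^ k).contMDiff x)).2
    rw [hfix k] at hk
    have hk' : ContDiffAt ℂ ω (fun z => φ ((g ^ k) (φ.symm z))) (φ x) := by
      rwa [modelWithCornersSelf_coe, Set.range_id, contDiffWithinAt_univ] at hk
    have h := hk'.hasStrictFDerivAt (by simp)
    have hder := hd k
    rw [((g ^ k).contMDiff.mdifferentiable (by simp) x).mfderiv] at hder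
    simp only [writtenInExtChartAt, hfix k, modelWithCornersSelf_coe, Set.range_id,
      fderivWithin_univ] at hder
    rw [← hder]
    exact h
  have hm0 : (m : ℂ) ≠ 0 := by exact_mod_cast hm.ne'
  have hsum : HasStrictFDerivAt (fun z => Φ (φ.symm z))
      ((ContinuousLinearEquiv.smulLeft (Units.mk0 (m : ℂ) hm0) : E ≃L[ℂ] E) : E →L[ℂ] E)
      (φ x) := by
    convert HasStrictFDerivAt.fun_sum (u := Finset.range m) fun k _ => hstrict k using 1
    ext v
    simp [Nat.cast_smul_eq_nsmul, Units.smul_def]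
  obtain ⟨ψ, hψ⟩ : ∃ ψ : E → E, ∀ᶠ z in 𝓝 (φ x), ψ (Φ (φ.symm z)) = z :=
    ⟨_, hsum.eventually_left_inverse⟩
  have hnear : ∀ᶠ y in 𝓝 x, y ∈ φ.source ∧ ψ (Φ y) = φ y := by
    have h1 := (continuousAt_extChartAt (I := 𝓘(ℂ, E)) x).eventually hψ
    have h2 : ∀ᶠ y in 𝓝 x, y ∈ φ.source := extChartAt_source_mem_nhds x
    filter_upwards [h1, h2] with y hy hys
    exact ⟨hys, by rwa [φ.left_inv hys] at hy⟩
  have hcont : Tendsto g (𝓝 x) (𝓝 x) := by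
    simpa [hgx] using g.continuous.tendsto x
  filter_upwards [hnear, hcont.eventually hnear] with y hy hgy
  exact φ.injOn hgy.1 hy.1 (by rw [← hgy.2, ← hy.2, hinv])

/-- The interior of the fixed-point set is closed: around a limit point `z`, which is fixed, `g` is
analytic on a chart ball and agrees with the identity near some point of that ball. -/
theorem eq_one_of_eventually_eq [T2Space F] [ConnectedSpace F] [CompleteSpace E]
    {g : HolomorphicDiffeo E F} {x : F} (hg : ∀ᶠ y in 𝓝 x, g y = y) : g = 1 := by
  set U : Set F := {z | ∀ᶠ y in 𝓝 z, g y = y} with hU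
  have hopen : IsOpen U := isOpen_setOfPred_eventually_nhds
  have hclosed : IsClosed U := by
    refine isClosed_of_closure_subset fun z hz => ?_
    have hfixed : IsClosed {y | g y = y} := isClosed_eq g.continuous continuous_id
    have hgz : g z = z := closure_minimal (fun y hy => Eventually.self_of_nhds hy) hfixed hz
    set φ := extChartAt 𝓘(ℂ, E) z with hφ
    have hk := (contMDiffAt_iff.1 (g.contMDiff z)).2
    rw [hgz] at hk
    have hk' : ContDiffAt ℂ ω (fun w => φ (g (φ.symm w))) (φ z) := by
      rwa [modelWithCornersSelf_coe, Set.range_id, contDiffWithinAt_univ] at hk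
    have han : ∀ᶠ w in 𝓝 (φ z), AnalyticAt ℂ (fun w => φ (g (φ.symm w))) w :=
      hk'.analyticAt.eventually_analyticAt
    have htarget : ∀ᶠ w in 𝓝 (φ z), w ∈ φ.target := extChartAt_target_mem_nhds z
    obtain ⟨r, hr, hball⟩ := Metric.eventually_nhds_iff_ball.1 (han.and htarget)
    have hW : ∀ᶠ y in 𝓝 z, y ∈ φ.source ∧ g y ∈ φ.source ∧ φ y ∈ Metric.ball (φ z) r := by
      have hs : ∀ᶠ y in 𝓝 z, y ∈ φ.source := extChartAt_source_mem_nhds z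
      have hcont : Tendsto g (𝓝 z) (𝓝 z) := by simpa [hgz] using g.continuous.tendsto z
      exact hs.and ((hcont.eventually hs).and ((continuousAt_extChartAt (I := 𝓘(ℂ, E)) z).eventually
        (Metric.ball_mem_nhds _ hr)))
    obtain ⟨y, hyW, hyU⟩ := mem_closure_iff_nhds.1 hz _ hW
    have hsymm : φ.symm (φ y) = y := φ.left_inv hyW.1
    have heq : (fun w => φ (g (φ.symm w))) =ᶠ[𝓝 (φ y)] id := by
      have hc : Tendsto φ.symm (𝓝 (φ y)) (𝓝 y) := by
        have := continuousAt_extChartAt_symm'' (I := 𝓘(ℂ, E)) (φ.map_source hyW.1)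
        rwa [ContinuousAt, hsymm] at this
      filter_upwards [hc.eventually hyU, (isOpen_extChartAt_target (I := 𝓘(ℂ, E)) z).mem_nhds
        (φ.map_source hyW.1)] with w hw hwt
      rw [hw, φ.right_inv hwt, id]
    have hEq := AnalyticOnNhd.eqOn_of_preconnected_of_eventuallyEq
      (fun w hw => (hball w hw).1) analyticOnNhd_id (convex_ball (φ z) r).isPreconnected
      hyW.2.2 heq
    filter_upwards [hW] with w hw
    have h := hEq hw.2.2
    simp only [φ.left_inv hw.1] at h
    exact φ.injOn hw.2.1 hw.1 h
  have huniv : U = Set.univ := IsClopen.eq_univ ⟨hclosed, hopen⟩ ⟨x, hg⟩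
  refine Diffeomorph.ext fun y => ?_
  have hy : ∀ᶠ w in 𝓝 y, g w = w := (huniv ▸ Set.mem_univ y : y ∈ U)
  exact hy.self_of_nhds

/-- The isotropy representation of the stabilizer of a point on the tangent space. -/
noncomputable def isotropyRep (G : Subgroup (HolomorphicDiffeo E F)) (x : F) :
    MulAction.stabilizer G x →* Module.End ℂ E where
  toFun g := ContinuousLinearMap.toLinearMap (R := ℂ) (S := ℂ) (σ := RingHom.id ℂ) (M := E)
    (M₂ := E) (mfderiv 𝓘(ℂ, E) 𝓘(ℂ, E) (g.1.1 : HolomorphicDiffeo E F) x)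
  map_one' := congrArg ContinuousLinearMap.toLinearMap (mfderiv_id (I := 𝓘(ℂ, E)) (x := x))
  map_mul' g h := by
    have hh : (h.1.1 : HolomorphicDiffeo E F) x = x := h.2
    have := mfderiv_comp_of_eq (x := x) (g.1.1.contMDiff.mdifferentiable (by simp) x)
      (h.1.1.contMDiff.mdifferentiable (by simp) x) hh
    rw [hh] at this
    exact congrArg ContinuousLinearMap.toLinearMap this

/-- Torsion is essential: `z ↦ z / (1 - z)` on the Riemann sphere fixes `0` with derivative `1`. -/
theorem isotropyRep_injective [T2Space F] [ConnectedSpace F] [CompleteSpace E]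
    [IsManifold 𝓘(ℂ, E) ω F] {G : Subgroup (HolomorphicDiffeo E F)} (hG : IsMulTorsion G) (x : F) :
    Function.Injective (isotropyRep G x) := by
  rw [injective_iff_map_eq_one]
  intro g hg
  obtain ⟨m, hm, hgm⟩ := (isOfFinOrder_iff_pow_eq_one).1 (hG g.1)
  have hgm' : g.1.1 ^ m = 1 := congrArg Subtype.val hgm
  refine Subtype.ext (Subtype.ext (eq_one_of_eventually_eq (x := x)
    (eventually_eq_of_fixed_of_mfderiv_eq_id hm hgm' g.2 fun k => ?_)))
  have hk : isotropyRep G x (g ^ k) = 1 := by rw [map_pow, hg, one_pow]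
  exact ContinuousLinearMap.ext fun v => LinearMap.congr_fun hk v

end HolomorphicDiffeo

/-! ### Conclusion. -/

theorem mainTheorem3 {E F : Type*} [NormedAddCommGroup E] [NormedSpace ℂ E]
    [FiniteDimensional ℂ E] [TopologicalSpace F] [T2Space F] [ConnectedSpace F]
    [ChartedSpace E F] [IsManifold 𝓘(ℂ, E) ω F]
    (G : Subgroup (HolomorphicDiffeo E F))
    (hG : Monoid.ExponentExists G ∨ (Group.FG G ∧ IsMulTorsion G))
    (horb : ∃ x : F, (MulAction.orbit G x).Finite) :
    Finite G := by
  have : CompleteSpace E := FiniteDimensional.complete ℂ E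
  obtain ⟨x, hx⟩ := horb
  have hindex : (MulAction.stabilizer G x).FiniteIndex := ⟨by
    rw [MulAction.index_stabilizer]
    exact (Set.ncard_pos hx).2 (MulAction.nonempty_orbit x) |>.ne'⟩
  refine (Subgroup.finite_iff_finite_and_finiteIndex (MulAction.stabilizer G x)).2 ⟨?_, hindex⟩
  rcases hG with hG | ⟨hfg, htor⟩
  · have htor : IsMulTorsion G := fun g => by
      obtain ⟨m, hm, h⟩ := hG
      exact isOfFinOrder_iff_pow_eq_one.2 ⟨m, hm, h g⟩
    obtain ⟨m, hm, h⟩ := hG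
    exact finite_of_exponentExists_of_injective_end
      ⟨m, hm, fun g => Subtype.ext (h g.1)⟩ _ (HolomorphicDiffeo.isotropyRep_injective htor x)
  · have htor' : IsMulTorsion (MulAction.stabilizer G x) := fun g =>
      Submonoid.isOfFinOrder_coe.1 (htor g.1)
    let e := LinearMap.toMatrixAlgEquiv (Module.finBasis ℂ E)
    let ρ := (MonoidHomClass.toMonoidHom e).comp (HolomorphicDiffeo.isotropyRep G x)
    have hρ : Function.Injective ρ :=
      e.injective.comp (HolomorphicDiffeo.isotropyRep_injective htor x)
    -- The stabilizer is finitely generated because it has finite index in `G` (Schreier); instance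
    -- search supplies this.
    exact finite_of_fg_of_isMulTorsion_of_injective_matrix htor' ρ hρ
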